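/- **Setting (linear AARA).** Annotated types are $A,B ::= \mathsf{int} \mid \mathbf 1 \mid A\times B \mid A^{p}+B^{r} \mid L^{p}(A) \mid A\xrightarrow{p/p'}B$ with constant annotations $p,p',r\in\mathbb R_{\ge 0}$. Expressions are $e ::= x \mid n \mid \langle\rangle \mid \mathbf{let}\,x=e_1\,\mathbf{in}\,e_2 \mid \langle e_1,e_2\rangle \mid \mathbf{letp}\,\langle x_1,x_2\rangle=e_1\,\mathbf{in}\,e_2 \mid \mathbf{left}(e)\mid\mathbf{right}(e)\mid \mathbf{case}\,e\{\mathbf{left}(x_1)\mapsto e_1\mid\mathbf{right}(x_2)\mapsto e_2\}\mid\mathbf{nil}\mid\mathbf{cons}(x_1,x_2)\mid\mathbf{case}\,x\{\mathbf{nil}\mapsto e_0\mid\mathbf{cons}(x_1,x_2)\mapsto e_1\}\mid x_1(x_2)\mid\mathbf{fun}\,f\,x=e\mid\mathbf{tick}\,t\mid\mathbf{share}\,x\,\mathbf{as}\,x_1,x_2\,\mathbf{in}\,e$ with $t\in\mathbb R$. General applications $e_1\,e_2$, $\mathbf{cons}(e_1,e_2)$ and $\mathrm{tick}\,t\,(e)$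 abbreviate their let-normal forms. The relation $A\curlyveedownarrow(A_1,A_2)$ splits the potential annotations of $A$ additively between $A_1$ and $A_2$ (componentwise; function types are copied). Subtyping $A<:B$ lets list and sum annotations decrease, is contravariant in function arguments, and lets function potentials $p/p'$ be replaced by $r/r'$ with $r\ge p$ and $r-r'\ge p-p'$. A resource metric assigns a constant cost $c_\bullet\ge 0$ to each syntactic construct (the metric with all constants zero counts only ticks). Judgements $\Gamma\vdash^{q}_{q'}e:A$ with constants $q,q'\ge 0$ are derived by the affine AARA rules, in which $\Gamma_1,\Gamma_2$ denotes disjoint contexts: * $x:A\vdash^{q}_{q'}x:A$ if $q\ge q'+c_{var}$; similarly for $n$, $\langle\rangle$ and $\mathbf{nil}:L^p(A)$; $\cdot\vdash^q_{q'}\mathbf{tick}\,t:\mathbf 1$ if $q\ge q'+t$; * $x_1:A,\,x_2:L^p(A)\vdash^q_{q'}\mathbf{cons}(x_1,x_2):L^p(A)$ if $q\ge q'+p+c_{cons}$; $\mathbf{left}(e)$, $\mathbf{right}(e)$ of type $A^p+B^r$ pay $p$, resp. $r$, analogously, and pairs pay no potential besides their cost; * $\mathbf{let}$: from $\Gamma_1\vdash^{q}_{r+c_{let2}}e_1:A$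 and $\Gamma_2,x:A\vdash^{r}_{q'+c_{let3}}e_2:B$ infer $\Gamma_1,\Gamma_2\vdash^{q+c_{let1}}_{q'}\mathbf{let}\,x=e_1\,\mathbf{in}\,e_2:B$; similarly for $\mathbf{letp}$; * list case: from $\Gamma\vdash^{q-c_{CaseNil}}_{q'}e_0:B$ and $\Gamma,x_1:A,x_2:L^p(A)\vdash^{q+p-c_{CaseCons}}_{q'}e_1:B$ infer the typing of the case expression in $\Gamma,x:L^p(A)$ with potentials $q/q'$; similarly for sums; * $x_1:A\xrightarrow{p/p'}B,\,x_2:A\vdash^q_{q'}x_1(x_2):B$ if $q\ge p+c_{app}$ and $q-q'\ge p-p'+c_{app}$; * from $\Gamma\curlyveedownarrow(\Gamma,\Gamma)$ (i.e. $\Gamma$ carries no potential), $\Gamma,f:A\xrightarrow{p/p'}B,x:A\vdash^p_{p'}e:B$ and $q\ge q'+c_{fun}$ infer $\Gamma\vdash^q_{q'}\mathbf{fun}\,f\,x=e:A\xrightarrow{p/p'}B$; * $\mathbf{share}$: from $A\curlyveedownarrow(A_1,A_2)$ and $\Gamma,x_1:A_1,x_2:A_2\vdash^q_{q'}e:B$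 infer $\Gamma,x:A\vdash^q_{q'}\mathbf{share}\,x\,\mathbf{as}\,x_1,x_2\,\mathbf{in}\,e:B$; * weakening of contexts, relaxation (from $\Gamma\vdash^p_{p'}e:A$ infer $\Gamma\vdash^q_{q'}e:A$ if $q\ge p$ and $q-q'\ge p-p'$), and subtyping for the result type and for the types in $\Gamma$. **Programs.** $$\mathit{append}=\mathbf{fun}\;\mathit{append}\;x=\mathbf{fun}\;\_\;y=\mathbf{case}\,x\,\{\mathbf{nil}\mapsto y\mid\mathbf{cons}(x_0,x_1)\mapsto\mathrm{tick}\,1\,(\mathbf{cons}(x_0,\mathit{append}\,x_1\,y))\},$$ $$\mathit{map}=\mathbf{fun}\;\mathit{map}\;z=\mathbf{fun}\;\_\;w=\mathbf{case}\,w\,\{\mathbf{nil}\mapsto\mathbf{nil}\mid\mathbf{cons}(w_0,w_1)\mapsto\mathbf{share}\,z\,\mathbf{as}\,z_1,z_2\,\mathbf{in}\,\mathbf{cons}(z_1\,w_0,\mathit{map}\,z_2\,w_1)\}.$$ **Theorem (Map Append is not typable in AARA).** For every resource metric with nonnegative constants: 1. for all expressions $\ell_1,\ell_2$ (in particular for variables),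 the program $\mathit{map}\,(\mathit{append}\,\ell_1)\,\ell_2$ has no typing: there are no context $\Gamma$, constants $q,q'\ge 0$ and type $A$ with $\Gamma\vdash^q_{q'}\mathit{map}\,(\mathit{append}\,\ell_1)\,\ell_2:A$; 2. for all expressions $e_1,e_2$, the term $\mathit{append}\,e_1\,e_2$ likewise has no typing. -/

import Mathlib

open scoped NNReal

namespace AARA

/-! ## Resource-annotated types, sharing and subtyping -/

/-- Resource-annotated types of linear AARA:
`int`, `1`, `A × B`, `A^p + B^r`, `L^p(A)` and `A →[p/p'] B`.
The annotations are nonnegative real constants. -/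
inductive Ty : Type
  | int : Ty
  | unit : Ty
  | prod (A B : Ty) : Ty
  | sum (A : Ty) (p : ℝ≥0) (B : Ty) (r : ℝ≥0) : Ty
  | list (p : ℝ≥0) (A : Ty) : Ty
  | arrow (A : Ty) (p p' : ℝ≥0) (B : Ty) : Ty

/-- The sharing relation `A ⋎ (A₁, A₂)`: the potential carried by `A` is split between
`A₁` and `A₂`. Functions carry no potential and are freely copied. -/
inductive Share : Ty → Ty → Ty → Prop
  | int : Share .int .int .int
  | unit : Share .unit .unit .unit
  | prod {A A₁ A₂ B B₁ B₂ : Ty} : Share A A₁ A₂ → Share B B₁ B₂ →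
      Share (.prod A B) (.prod A₁ B₁) (.prod A₂ B₂)
  | sum {A A₁ A₂ B B₁ B₂ : Ty} {p p₁ p₂ r r₁ r₂ : ℝ≥0} : Share A A₁ A₂ → p = p₁ + p₂ →
      Share B B₁ B₂ → r = r₁ + r₂ → Share (.sum A p B r) (.sum A₁ p₁ B₁ r₁) (.sum A₂ p₂ B₂ r₂)
  | list {A A₁ A₂ : Ty} {p p₁ p₂ : ℝ≥0} : Share A A₁ A₂ → p = p₁ + p₂ →
      Share (.list p A) (.list p₁ A₁) (.list p₂ A₂)
  | arrow {A B : Ty} {p p' : ℝ≥0} :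
      Share (.arrow A p p' B) (.arrow A p p' B) (.arrow A p p' B)

/-- Subtyping `A <: B`: `A` and `B` have the same shape and `A` carries at least the potential
of `B`; contravariant in function arguments, and a function with potentials `p/p'` may be used
with potentials `r/r'` if `r ≥ p` and `r - r' ≥ p - p'`. -/
inductive Sub : Ty → Ty → Prop
  | int : Sub .int .int
  | unit : Sub .unit .unit
  | prod {A A' B B' : Ty} : Sub A A' → Sub B B' → Sub (.prod A B) (.prod A' B')
  | sum {A A' B B' : Ty} {p p' r r' : ℝ≥0} : Sub A A' → p' ≤ p → Sub B B' → r' ≤ r →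
      Sub (.sum A p B r) (.sum A' p' B' r')
  | list {A A' : Ty} {p p' : ℝ≥0} : Sub A A' → p' ≤ p → Sub (.list p A) (.list p' A')
  | arrow {A A' B B' : Ty} {p p' r r' : ℝ≥0} : Sub A' A → Sub B B' →
      p ≤ r → r' + p ≤ r + p' → Sub (.arrow A p p' B) (.arrow A' r r' B')

/-! ## Expressions -/

/-- Expressions of AARA (in let-normal form); variables are natural numbers. -/
inductive Expr : Type
  | var (x : ℕ) : Expr
  | int (n : ℤ) : Expr
  | unit : Expr
  /-- `let x = e₁ in e₂` -/
  | letE (x : ℕ) (e₁ e₂ : Expr) : Expr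
  /-- `⟨e₁, e₂⟩` -/
  | pair (e₁ e₂ : Expr) : Expr
  /-- `letp ⟨x₁, x₂⟩ = e₁ in e₂` -/
  | letp (x₁ x₂ : ℕ) (e₁ e₂ : Expr) : Expr
  | left (e : Expr) : Expr
  | right (e : Expr) : Expr
  /-- `case e { left(x₁) ↦ e₁ | right(x₂) ↦ e₂ }` -/
  | caseSum (e : Expr) (x₁ : ℕ) (e₁ : Expr) (x₂ : ℕ) (e₂ : Expr) : Expr
  | nil : Expr
  /-- `cons(x₁, x₂)` -/
  | cons (x₁ x₂ : ℕ) : Expr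
  /-- `case x { nil ↦ e₀ | cons(x₁, x₂) ↦ e₁ }` -/
  | caseList (x : ℕ) (e₀ : Expr) (x₁ x₂ : ℕ) (e₁ : Expr) : Expr
  /-- `x₁(x₂)` -/
  | app (x₁ x₂ : ℕ) : Expr
  /-- the recursive function `fun f x = e` -/
  | fn (f x : ℕ) (e : Expr) : Expr
  /-- `tick t` consumes `t` units of resource (releases `-t` units if `t < 0`) -/
  | tick (t : ℝ) : Expr
  /-- `share x as x₁, x₂ in e` -/
  | share (x x₁ x₂ : ℕ) (e : Expr) : Expr

/-- A number larger than every variable that occurs in the expression. -/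
def Expr.fresh : Expr → ℕ
  | .var x => x + 1
  | .int _ => 0
  | .unit => 0
  | .letE x e₁ e₂ => max (x + 1) (max e₁.fresh e₂.fresh)
  | .pair e₁ e₂ => max e₁.fresh e₂.fresh
  | .letp x₁ x₂ e₁ e₂ => max (max (x₁ + 1) (x₂ + 1)) (max e₁.fresh e₂.fresh)
  | .left e => e.fresh
  | .right e => e.fresh
  | .caseSum e x₁ e₁ x₂ e₂ =>
      max e.fresh (max (max (x₁ + 1) (x₂ + 1)) (max e₁.fresh e₂.fresh))
  | .nil => 0
  | .cons x₁ x₂ => max (x₁ + 1) (x₂ + 1)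
  | .caseList x e₀ x₁ x₂ e₁ =>
      max (x + 1) (max (max (x₁ + 1) (x₂ + 1)) (max e₀.fresh e₁.fresh))
  | .app x₁ x₂ => max (x₁ + 1) (x₂ + 1)
  | .fn f x e => max (max (f + 1) (x + 1)) e.fresh
  | .tick _ => 0
  | .share x x₁ x₂ e => max (x + 1) (max (max (x₁ + 1) (x₂ + 1)) e.fresh)

/-- Application `e₁ e₂` of arbitrary expressions, in let-normal form:
`let f = e₁ in let a = e₂ in f(a)` with `f`, `a` distinct and not occurring in `e₂`. -/
def Expr.appE (e₁ e₂ : Expr) : Expr :=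
  .letE e₂.fresh e₁ (.letE (e₂.fresh + 1) e₂ (.app e₂.fresh (e₂.fresh + 1)))

/-- `cons(e₁, e₂)` for arbitrary expressions, in let-normal form. -/
def Expr.consE (e₁ e₂ : Expr) : Expr :=
  .letE e₂.fresh e₁ (.letE (e₂.fresh + 1) e₂ (.cons e₂.fresh (e₂.fresh + 1)))

/-- `tick t e`: consume `t` units of resource, then evaluate `e`. -/
def Expr.tickE (t : ℝ) (e : Expr) : Expr :=
  .letE e.fresh (.tick t) e

/-! ## Typing contexts -/

/-- A typing context assigns annotated types to (some) variables. -/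
abbrev Ctx : Type := ℕ → Option Ty

/-- The empty context. -/
def Ctx.empty : Ctx := fun _ => none

/-- The context `Γ, x : A` (a binding of `x` in `Γ` is shadowed). -/
def Ctx.insert (Γ : Ctx) (x : ℕ) (A : Ty) : Ctx := Function.update Γ x (some A)

/-- `Γ = Γ₁, Γ₂`: every binding of `Γ` goes to exactly one of `Γ₁`, `Γ₂`. -/
def Ctx.Split (Γ Γ₁ Γ₂ : Ctx) : Prop :=
  ∀ x, (Γ₁ x = Γ x ∧ Γ₂ x = none) ∨ (Γ₁ x = none ∧ Γ₂ x = Γ x)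

/-- `Γ ⋎ (Γ, Γ)`: no type in `Γ` carries potential. -/
def Ctx.PotentialFree (Γ : Ctx) : Prop :=
  ∀ x A, Γ x = some A → Share A A A

/-! ## Typing rules -/

/-- The resource metric: the cost of each syntactic construct (in addition to explicit `tick`s). -/
structure CostMetric : Type where
  (var int unit let₁ let₂ let₃ pair letp left right caseLeft caseRight nil cons caseNil caseCons
    app fn : ℝ≥0)

/-- The AARA typing judgement: `Typing M Γ q e q' A` says that, for the metric `M`, in the
context `Γ` and with `q` units of constant potential, `e` has the type `A`, and `q'` units of
constant potential are left after its evaluation. -/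
inductive Typing (M : CostMetric) : Ctx → ℝ≥0 → Expr → ℝ≥0 → Ty → Prop
  | var {x : ℕ} {A : Ty} {q q' : ℝ≥0} (hq : q' + M.var ≤ q) :
      Typing M (Ctx.empty.insert x A) q (.var x) q' A
  | int {n : ℤ} {q q' : ℝ≥0} (hq : q' + M.int ≤ q) :
      Typing M Ctx.empty q (.int n) q' .int
  | unit {q q' : ℝ≥0} (hq : q' + M.unit ≤ q) :
      Typing M Ctx.empty q .unit q' .unit
  | tick {t : ℝ} {q q' : ℝ≥0} (hq : (q' : ℝ) + t ≤ q) :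
      Typing M Ctx.empty q (.tick t) q' .unit
  | letE {Γ Γ₁ Γ₂ : Ctx} {x : ℕ} {e₁ e₂ : Expr} {A B : Ty} {q r q' : ℝ≥0}
      (hΓ : Γ.Split Γ₁ Γ₂)
      (h₁ : Typing M Γ₁ q e₁ (r + M.let₂) A)
      (h₂ : Typing M (Γ₂.insert x A) r e₂ (q' + M.let₃) B) :
      Typing M Γ (q + M.let₁) (.letE x e₁ e₂) q' B
  | pair {Γ Γ₁ Γ₂ : Ctx} {e₁ e₂ : Expr} {A B : Ty} {q r q' : ℝ≥0}
      (hΓ : Γ.Split Γ₁ Γ₂)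
      (h₁ : Typing M Γ₁ q e₁ r A)
      (h₂ : Typing M Γ₂ r e₂ (q' + M.pair) B) :
      Typing M Γ q (.pair e₁ e₂) q' (.prod A B)
  | letp {Γ Γ₁ Γ₂ : Ctx} {x₁ x₂ : ℕ} {e₁ e₂ : Expr} {A B C : Ty} {q r q' : ℝ≥0}
      (hΓ : Γ.Split Γ₁ Γ₂)
      (h₁ : Typing M Γ₁ q e₁ (r + M.letp) (.prod A B))
      (h₂ : Typing M ((Γ₂.insert x₁ A).insert x₂ B) r e₂ q' C) :
      Typing M Γ q (.letp x₁ x₂ e₁ e₂) q' C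
  | left {Γ : Ctx} {e : Expr} {A B : Ty} {p r q q' : ℝ≥0}
      (h : Typing M Γ q e (q' + p + M.left) A) :
      Typing M Γ q (.left e) q' (.sum A p B r)
  | right {Γ : Ctx} {e : Expr} {A B : Ty} {p r q q' : ℝ≥0}
      (h : Typing M Γ q e (q' + r + M.right) B) :
      Typing M Γ q (.right e) q' (.sum A p B r)
  | caseSum {Γ Γ₁ Γ₂ : Ctx} {e e₁ e₂ : Expr} {x₁ x₂ : ℕ} {A B C : Ty}
      {p r q s s₁ s₂ q' : ℝ≥0}
      (hΓ : Γ.Split Γ₁ Γ₂)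
      (h : Typing M Γ₁ q e s (.sum A p B r))
      (hs₁ : s₁ + M.caseLeft = s + p) (hs₂ : s₂ + M.caseRight = s + r)
      (h₁ : Typing M (Γ₂.insert x₁ A) s₁ e₁ q' C)
      (h₂ : Typing M (Γ₂.insert x₂ B) s₂ e₂ q' C) :
      Typing M Γ q (.caseSum e x₁ e₁ x₂ e₂) q' C
  | nil {A : Ty} {p q q' : ℝ≥0} (hq : q' + M.nil ≤ q) :
      Typing M Ctx.empty q .nil q' (.list p A)
  | cons {x₁ x₂ : ℕ} {A : Ty} {p q q' : ℝ≥0} (hx : x₁ ≠ x₂) (hq : q' + p + M.cons ≤ q) :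
      Typing M ((Ctx.empty.insert x₁ A).insert x₂ (.list p A)) q (.cons x₁ x₂) q' (.list p A)
  | caseList {Γ : Ctx} {x x₁ x₂ : ℕ} {e₀ e₁ : Expr} {A B : Ty} {p q s₀ s₁ q' : ℝ≥0}
      (hx : Γ x = none)
      (hs₀ : s₀ + M.caseNil = q) (hs₁ : s₁ + M.caseCons = q + p)
      (h₀ : Typing M Γ s₀ e₀ q' B)
      (h₁ : Typing M ((Γ.insert x₁ A).insert x₂ (.list p A)) s₁ e₁ q' B) :
      Typing M (Γ.insert x (.list p A)) q (.caseList x e₀ x₁ x₂ e₁) q' B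
  | app {x₁ x₂ : ℕ} {A B : Ty} {p p' q q' : ℝ≥0} (hx : x₁ ≠ x₂)
      (hq : p + M.app ≤ q) (hqq' : q' + p + M.app ≤ q + p') :
      Typing M ((Ctx.empty.insert x₁ (.arrow A p p' B)).insert x₂ A) q (.app x₁ x₂) q' B
  | fn {Γ : Ctx} {f x : ℕ} {e : Expr} {A B : Ty} {p p' q q' : ℝ≥0}
      (hΓ : Γ.PotentialFree)
      (h : Typing M ((Γ.insert f (.arrow A p p' B)).insert x A) p e p' B)
      (hq : q' + M.fn ≤ q) :
      Typing M Γ q (.fn f x e) q' (.arrow A p p' B)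
  | share {Γ : Ctx} {x x₁ x₂ : ℕ} {e : Expr} {A A₁ A₂ B : Ty} {q q' : ℝ≥0}
      (hx : Γ x = none) (hA : Share A A₁ A₂)
      (h : Typing M ((Γ.insert x₁ A₁).insert x₂ A₂) q e q' B) :
      Typing M (Γ.insert x A) q (.share x x₁ x₂ e) q' B
  | relax {Γ : Ctx} {e : Expr} {A : Ty} {p p' q q' : ℝ≥0}
      (h : Typing M Γ p e p' A) (hq : p ≤ q) (hqq' : q' + p ≤ q + p') :
      Typing M Γ q e q' A
  | weak {Γ : Ctx} {x : ℕ} {e : Expr} {A B : Ty} {q q' : ℝ≥0}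
      (hx : Γ x = none) (h : Typing M Γ q e q' B) :
      Typing M (Γ.insert x A) q e q' B
  | sub {Γ : Ctx} {e : Expr} {A B : Ty} {q q' : ℝ≥0}
      (h : Typing M Γ q e q' A) (hAB : Sub A B) :
      Typing M Γ q e q' B
  | sup {Γ : Ctx} {x : ℕ} {e : Expr} {A B C : Ty} {q q' : ℝ≥0}
      (hx : Γ x = none) (h : Typing M (Γ.insert x B) q e q' C) (hAB : Sub A B) :
      Typing M (Γ.insert x A) q e q' C

/-- `e` has some typing: for some context, some constant potentials and some type. -/
def Typable (M : CostMetric) (e : Expr) : Prop :=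
  ∃ (Γ : Ctx) (q q' : ℝ≥0) (A : Ty), Typing M Γ q e q' A

/-! ## The programs -/

/-- The curried list append; its cost is one unit per recursive call:
`fun append x = fun _ y =
  case x { nil ↦ y | cons(x₀, x₁) ↦ tick 1 (cons(x₀, append x₁ y)) }`,
with variables `append = 0`, `x = 1`, `_ = 2`, `y = 3`, `x₀ = 4`, `x₁ = 5`. -/
noncomputable def append : Expr :=
  .fn 0 1 (.fn 2 3 (.caseList 1 (.var 3) 4 5
    (.tickE 1 (.consE (.var 4) (.appE (.appE (.var 0) (.var 5)) (.var 3))))))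

/-- The curried list map:
`fun map z = fun _ w =
  case w { nil ↦ nil | cons(w₀, w₁) ↦ share z as z₁, z₂ in cons(z₁ w₀, map z₂ w₁) }`,
with variables `map = 0`, `z = 1`, `_ = 2`, `w = 3`, `w₀ = 4`, `w₁ = 5`, `z₁ = 6`, `z₂ = 7`. -/
def map : Expr :=
  .fn 0 1 (.fn 2 3 (.caseList 3 .nil 4 5
    (.share 1 6 7 (.consE (.appE (.var 6) (.var 4)) (.appE (.appE (.var 0) (.var 7)) (.var 5))))))

/-- The program `map (append ℓ₁) ℓ₂`. -/
noncomputable def mapAppend (ℓ₁ ℓ₂ : Expr) : Expr :=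
  .appE (.appE map (.appE append ℓ₁)) ℓ₂

end AARA

namespace AARA

/-! The obstruction is in `append`. The inner closure captures the list `x`, and a function body may
use only potential-free variables, so `x` has type `L^0(A)` and the case analysis releases nothing.
Let the inner body be typed with `p/p'`. Its cons branch pays one tick, applies the recursive
function at net cost at least 0, then calls the resulting closure at net cost at least `p - p'`,
since subtyping never lowers `p - p'`. Hence `p - p' ≥ 1 + (p - p')`, which is absurd. `CostAtLeast`
bounds the net cost `q - q'` below by induction on derivations, `fn_inversion` exposes the two
function bodies, and `not_typable_append` combines them. -/

/-- A family of properties of types that is preserved when passing to a supertype. -/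
def SubClosed (Q : Ty → Prop) : Prop :=
  ∀ ⦃A B : Ty⦄, Sub A B → Q A → Q B

/-- Every binding `x : A` of the context satisfies `P x A`. -/
def Ctx.Sat (P : ℕ → Ty → Prop) (Γ : Ctx) : Prop :=
  ∀ x A, Γ x = some A → P x A

namespace Ctx.Sat

variable {P R : ℕ → Ty → Prop} {Γ Γ₁ Γ₂ : Ctx} {x : ℕ} {A B : Ty}

theorem insert (h : Γ.Sat P) (hx : R x A) (hP : ∀ y B, y ≠ x → P y B → R y B) :
    (Γ.insert x A).Sat R := by
  intro y B hy
  by_cases hyx : y = x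
  · subst hyx
    simp only [Ctx.insert, Function.update_self, Option.some.injEq] at hy
    exact hy ▸ hx
  · rw [Ctx.insert, Function.update_of_ne hyx] at hy
    exact hP y B hyx (h y B hy)

theorem head (h : (Γ.insert x A).Sat P) : P x A :=
  h x A (by simp [Ctx.insert])

theorem tail (h : (Γ.insert x A).Sat P) (hx : Γ x = none) : Γ.Sat P := by
  intro y B hy
  have hyx : y ≠ x := by
    rintro rfl
    simp [hx] at hy
  exact h y B (by rwa [Ctx.insert, Function.update_of_ne hyx])

/-- Read upwards, the `sup` typing rule replaces a binding by a supertype; this is why invariants of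
contexts must be closed under supertypes. -/
theorem sup (hP : ∀ y, SubClosed (P y)) (h : (Γ.insert x A).Sat P) (hx : Γ x = none)
    (hAB : Sub A B) : (Γ.insert x B).Sat P :=
  (h.tail hx).insert (hP x hAB h.head) fun _ _ _ hy => hy

theorem split_left (h : Γ.Sat P) (hΓ : Γ.Split Γ₁ Γ₂) : Γ₁.Sat P := by
  intro y B hy
  rcases hΓ y with ⟨h₁, -⟩ | ⟨h₁, -⟩
  · exact h y B (h₁ ▸ hy)
  · simp [h₁] at hy

theorem split_right (h : Γ.Sat P) (hΓ : Γ.Split Γ₁ Γ₂) : Γ₂.Sat P := by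
  intro y B hy
  rcases hΓ y with ⟨-, h₂⟩ | ⟨-, h₂⟩
  · simp [h₂] at hy
  · exact h y B (h₂ ▸ hy)

end Ctx.Sat

/-- In contexts that satisfy `P`, every typing of `e` consumes at least `d` units of constant
potential (net) and has a type that satisfies `Q`. -/
def CostAtLeast (M : CostMetric) (P : ℕ → Ty → Prop) (e : Expr) (d : ℝ) (Q : Ty → Prop) : Prop :=
  ∀ ⦃Γ : Ctx⦄ ⦃q q' : ℝ≥0⦄ ⦃A : Ty⦄, Typing M Γ q e q' A → Γ.Sat P → (q' : ℝ) + d ≤ q ∧ Q A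

/-- A function type whose functions consume at least `d` units of constant potential (net) and
whose result type satisfies `Q`. -/
def FunSpec (d : ℝ) (Q : Ty → Prop) (T : Ty) : Prop :=
  ∃ (A : Ty) (p p' : ℝ≥0) (B : Ty), T = .arrow A p p' B ∧ (p' : ℝ) + d ≤ p ∧ Q B

/-- If the type is a list type, then it assigns no potential to the list cells. -/
def ListFree (T : Ty) : Prop :=
  ∀ p A, T = .list p A → p = 0

theorem subClosed_true : SubClosed fun _ => True := fun _ _ _ _ => trivial

/-- With `c` of the form `y = i`, this gives invariants that constrain only the variable `i`. -/
theorem SubClosed.imp {Q : Ty → Prop} (hQ : SubClosed Q) (c : Prop) :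
    SubClosed fun T => c → Q T :=
  fun _ _ hAB hA hc => hQ hAB (hA hc)

theorem SubClosed.and {Q R : Ty → Prop} (hQ : SubClosed Q) (hR : SubClosed R) :
    SubClosed fun T => Q T ∧ R T :=
  fun _ _ hAB hA => ⟨hQ hAB hA.1, hR hAB hA.2⟩

theorem SubClosed.funSpec {Q : Ty → Prop} (hQ : SubClosed Q) (d : ℝ) :
    SubClosed (FunSpec d Q) := by
  rintro T T' h ⟨A, p, p', B, rfl, hd, hB⟩
  cases h with
  | arrow _ hBB hp hpp =>
    refine ⟨_, _, _, _, rfl, ?_, hQ hBB hB⟩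
    have : ((_ : ℝ≥0) : ℝ) ≤ ((_ : ℝ≥0) : ℝ) := NNReal.coe_le_coe.2 hpp
    push_cast at this
    linarith

theorem subClosed_listFree : SubClosed ListFree := by
  rintro T T' h hT p A rfl
  cases h with
  | list _ hp =>
    rw [hT _ _ rfl] at hp
    exact le_antisymm hp zero_le

/-- Sharing with itself forces `p = p + p`. -/
theorem Share.listFree {T : Ty} (h : Share T T T) : ListFree T := by
  rintro p A rfl
  cases h with
  | list _ hp => simpa using hp

theorem relax_cost {d : ℝ} {p p' q q' : ℝ≥0} (hqq' : q' + p ≤ q + p') (h : (p' : ℝ) + d ≤ p) :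
    (q' : ℝ) + d ≤ q := by
  have := NNReal.coe_le_coe.2 hqq'
  push_cast at this
  linarith

/-! ### Lower bounds on net cost, construct by construct -/

section Rules

variable {M : CostMetric} {P R : ℕ → Ty → Prop} {Q : Ty → Prop}

theorem costAtLeast_var (hP : ∀ y, SubClosed (P y)) (x : ℕ) :
    CostAtLeast M P (.var x) 0 (P x) := by
  intro Γ q q' A h hΓ
  generalize he : Expr.var x = e at h
  induction h <;> cases he
  case var hq =>
    have := NNReal.coe_le_coe.2 hq
    have := M.var.coe_nonneg
    push_cast at *
    exact ⟨by linarith, hΓ.head⟩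
  case relax hqq' _ ih => exact ⟨relax_cost hqq' (ih hΓ rfl).1, (ih hΓ rfl).2⟩
  case weak hx _ ih => exact ih (hΓ.tail hx) rfl
  case sub hAB _ ih => exact ⟨(ih hΓ rfl).1, hP x hAB (ih hΓ rfl).2⟩
  case sup hx hAB _ ih => exact ih (hΓ.sup hP hx hAB) rfl

theorem costAtLeast_tick (hP : ∀ y, SubClosed (P y)) (t : ℝ) :
    CostAtLeast M P (.tick t) t fun _ => True := by
  intro Γ q q' A h hΓ
  generalize he : Expr.tick t = e at h
  induction h <;> cases he
  case tick hq => exact ⟨hq, trivial⟩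
  case relax hqq' _ ih => exact ⟨relax_cost hqq' (ih hΓ rfl).1, trivial⟩
  case weak hx _ ih => exact ih (hΓ.tail hx) rfl
  case sub ih => exact ih hΓ rfl
  case sup hx hAB _ ih => exact ih (hΓ.sup hP hx hAB) rfl

theorem costAtLeast_cons (hP : ∀ y, SubClosed (P y)) (x₁ x₂ : ℕ) :
    CostAtLeast M P (.cons x₁ x₂) 0 fun _ => True := by
  intro Γ q q' A h hΓ
  generalize he : Expr.cons x₁ x₂ = e at h
  induction h <;> cases he
  case cons p _ _ hq _ =>
    have := NNReal.coe_le_coe.2 hq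
    have := M.cons.coe_nonneg
    have := p.coe_nonneg
    push_cast at *
    exact ⟨by linarith, trivial⟩
  case relax hqq' _ ih => exact ⟨relax_cost hqq' (ih hΓ rfl).1, trivial⟩
  case weak hx _ ih => exact ih (hΓ.tail hx) rfl
  case sub ih => exact ih hΓ rfl
  case sup hx hAB _ ih => exact ih (hΓ.sup hP hx hAB) rfl

theorem costAtLeast_app (hP : ∀ y, SubClosed (P y)) (hQ : SubClosed Q) {x₁ x₂ : ℕ} {d : ℝ}
    (hx₁ : ∀ T, P x₁ T → FunSpec d Q T) :
    CostAtLeast M P (.app x₁ x₂) d Q := by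
  intro Γ q q' A h hΓ
  generalize he : Expr.app x₁ x₂ = e at h
  induction h <;> cases he
  case app hqq' hx =>
    obtain ⟨_, _, _, _, hT, hd, hB⟩ :=
      hx₁ _ (hΓ x₁ _ ((Function.update_of_ne hx _ _).trans (Function.update_self _ _ _)))
    cases hT
    have := NNReal.coe_le_coe.2 hqq'
    have := M.app.coe_nonneg
    push_cast at *
    exact ⟨by linarith, hB⟩
  case relax hqq' _ ih => exact ⟨relax_cost hqq' (ih hΓ rfl).1, (ih hΓ rfl).2⟩
  case weak hx _ ih => exact ih (hΓ.tail hx) rfl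
  case sub hAB _ ih => exact ⟨(ih hΓ rfl).1, hQ hAB (ih hΓ rfl).2⟩
  case sup hx hAB _ ih => exact ih (hΓ.sup hP hx hAB) rfl

theorem CostAtLeast.letE {Q' : Ty → Prop} {x : ℕ} {e₁ e₂ : Expr} {d₁ d₂ : ℝ}
    (hP : ∀ y, SubClosed (P y)) (hQ : SubClosed Q)
    (h₁ : CostAtLeast M P e₁ d₁ Q') (h₂ : CostAtLeast M R e₂ d₂ Q)
    (hx : ∀ A, Q' A → R x A) (hR : ∀ y A, y ≠ x → P y A → R y A) :
    CostAtLeast M P (.letE x e₁ e₂) (d₁ + d₂) Q := by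
  intro Γ q q' A h hΓ
  generalize he : Expr.letE x e₁ e₂ = e at h
  induction h <;> cases he
  case letE hs ht₁ _ ht₂ _ =>
    obtain ⟨hd₁, hA⟩ := h₁ ht₁ (hΓ.split_left hs)
    obtain ⟨hd₂, hB⟩ := h₂ ht₂ ((hΓ.split_right hs).insert (hx _ hA) hR)
    have := M.let₁.coe_nonneg
    have := M.let₂.coe_nonneg
    have := M.let₃.coe_nonneg
    push_cast at *
    exact ⟨by linarith, hB⟩
  case relax hqq' _ ih => exact ⟨relax_cost hqq' (ih hΓ rfl).1, (ih hΓ rfl).2⟩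
  case weak hx _ ih => exact ih (hΓ.tail hx) rfl
  case sub hAB _ ih => exact ⟨(ih hΓ rfl).1, hQ hAB (ih hΓ rfl).2⟩
  case sup hx hAB _ ih => exact ih (hΓ.sup hP hx hAB) rfl

/-- A case distinction on a list without potential is at least as expensive as its
`cons` branch. -/
theorem CostAtLeast.caseList {x x₁ x₂ : ℕ} {e₀ e₁ : Expr} {d : ℝ}
    (hP : ∀ y, SubClosed (P y)) (hQ : SubClosed Q)
    (hx : ∀ T, P x T → ListFree T) (h₁ : CostAtLeast M R e₁ d Q)
    (hx₁ : ∀ A, R x₁ A) (hx₂ : ∀ A, R x₂ A) (hR : ∀ y A, P y A → R y A) :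
    CostAtLeast M P (.caseList x e₀ x₁ x₂ e₁) d Q := by
  intro Γ q q' A h hΓ
  generalize he : Expr.caseList x e₀ x₁ x₂ e₁ = e at h
  induction h <;> cases he
  case caseList _ hs₁ hxΓ _ _ ht₁ _ =>
    obtain ⟨hd, hB⟩ := h₁ ht₁ (((hΓ.tail hxΓ).insert (hx₁ _) fun y A _ => hR y A).insert
      (hx₂ _) fun _ _ _ hy => hy)
    -- The scrutinee has no cell potential, so the cons branch starts with at most `q`.
    rw [hx _ hΓ.head _ _ rfl, add_zero] at hs₁
    have := congrArg NNReal.toReal hs₁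
    have := M.caseCons.coe_nonneg
    push_cast at *
    exact ⟨by linarith, hB⟩
  case relax hqq' _ ih => exact ⟨relax_cost hqq' (ih hΓ rfl).1, (ih hΓ rfl).2⟩
  case weak hx _ ih => exact ih (hΓ.tail hx) rfl
  case sub hAB _ ih => exact ⟨(ih hΓ rfl).1, hQ hAB (ih hΓ rfl).2⟩
  case sup hx hAB _ ih => exact ih (hΓ.sup hP hx hAB) rfl

theorem CostAtLeast.appE_var {e : Expr} {d₁ d : ℝ} (hP : ∀ y, SubClosed (P y)) (hQ : SubClosed Q)
    (h : CostAtLeast M P e d₁ (FunSpec d Q)) (y : ℕ) :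
    CostAtLeast M P (e.appE (.var y)) (d₁ + d) Q := by
  -- `y + 1` is the fresh name to which `appE` binds the function; nothing else needs tracking from
  -- here on.
  have hR (z : ℕ) : SubClosed fun T => z = y + 1 → FunSpec d Q T := (hQ.funSpec d).imp _
  have h₂ : CostAtLeast M (fun z T => z = y + 1 → FunSpec d Q T)
      (.letE (y + 2) (.var y) (.app (y + 1) (y + 2))) (0 + d) Q :=
    (costAtLeast_var hR y).letE hR hQ (costAtLeast_app hR hQ fun _ hT => hT rfl)
      (fun _ _ hy => by omega) fun _ _ _ hz => hz
  rw [zero_add] at h₂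
  exact h.letE hP hQ h₂ (fun _ hA _ => hA) fun _ _ hz _ hzx => absurd hzx hz

/-- Structural rules may separate `Γ` from the context `Γ₀` of the `fn` rule, and `T` from its arrow
type. Only supertype-closed facts are transported from `Γ` to `Γ₀`, and `T` keeps the net cost of
the body as a lower bound. -/
theorem fn_inversion {Γ : Ctx} {f x : ℕ} {e : Expr} {q q' : ℝ≥0} {T : Ty}
    (h : Typing M Γ q (.fn f x e) q' T) :
    (q' : ℝ) ≤ q ∧ ∃ (Γ₀ : Ctx) (A : Ty) (p p' : ℝ≥0) (B : Ty), Γ₀.PotentialFree ∧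
      (∀ P : ℕ → Ty → Prop, (∀ y, SubClosed (P y)) → Γ.Sat P → Γ₀.Sat P) ∧
      Typing M ((Γ₀.insert f (.arrow A p p' B)).insert x A) p e p' B ∧
      FunSpec ((p : ℝ) - p') (fun _ => True) T := by
  generalize he : Expr.fn f x e = e' at h
  induction h <;> cases he
  case fn p p' _ _ hpf hq ht _ =>
    have := NNReal.coe_le_coe.2 hq
    have := M.fn.coe_nonneg
    push_cast at *
    exact ⟨by linarith, _, _, _, _, _, hpf, fun _ _ h => h, ht, _, _, _, _, rfl, by linarith,
      trivial⟩
  case relax hqq' _ ih =>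
    obtain ⟨hle, h⟩ := ih rfl
    have := relax_cost (d := 0) hqq' (by linarith)
    exact ⟨by linarith, h⟩
  case weak hx _ ih =>
    obtain ⟨hle, Γ₀, A, p, p', B, hpf, hsat, h⟩ := ih rfl
    exact ⟨hle, Γ₀, A, p, p', B, hpf, fun P hP hΓ => hsat P hP (hΓ.tail hx), h⟩
  case sub hAB _ ih =>
    obtain ⟨hle, Γ₀, A, p, p', B, hpf, hsat, ht, hT⟩ := ih rfl
    exact ⟨hle, Γ₀, A, p, p', B, hpf, hsat, ht, subClosed_true.funSpec _ hAB hT⟩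
  case sup hx hAB _ ih =>
    obtain ⟨hle, Γ₀, A, p, p', B, hpf, hsat, h⟩ := ih rfl
    exact ⟨hle, Γ₀, A, p, p', B, hpf, fun P hP hΓ => hsat P hP (hΓ.sup hP hx hAB), h⟩

end Rules

/-! ### Untypability of `append` -/

/-- The recursive branch of `append` costs one unit more than a call of the partially applied
recursive function. -/
theorem costAtLeast_append_branch (M : CostMetric) (d : ℝ) :
    CostAtLeast M (fun y T => y = 0 → FunSpec 0 (FunSpec d fun _ => True) T)
      (.tickE 1 (.consE (.var 4) (.appE (.appE (.var 0) (.var 5)) (.var 3)))) (1 + d)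
      fun _ => True := by
  have hQ : SubClosed (FunSpec d fun _ => True) := subClosed_true.funSpec d
  have hP (y : ℕ) : SubClosed fun T => y = 0 → FunSpec 0 (FunSpec d fun _ => True) T :=
    (hQ.funSpec 0).imp _
  have hf : CostAtLeast M _ (.var 0) 0 (FunSpec 0 (FunSpec d fun _ => True)) :=
    fun _ _ _ _ h hΓ => (costAtLeast_var hP 0 h hΓ).imp_right fun h => h rfl
  have happ := (hf.appE_var hP hQ 5).appE_var hP subClosed_true 3
  -- 8, 9 and below 10 are the names that `fresh` yields in `consE` and `tickE`.
  have hcons := (costAtLeast_var (M := M) hP 4).letE (x := 8) hP subClosed_true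
    (happ.letE (x := 9) hP subClosed_true (costAtLeast_cons hP 8 9)
      (fun _ _ h => by omega) fun _ _ _ h => h)
    (fun _ _ h => by omega) fun _ _ _ h => h
  have htick := (costAtLeast_tick (M := M) hP 1).letE (x := 10) hP subClosed_true hcons
    (fun _ _ h => by omega) fun _ _ _ h => h
  simp only [zero_add, add_zero] at htick
  exact htick

theorem not_typable_append (M : CostMetric) : ¬ Typable M append := by
  rintro ⟨Γ, q, q', T, h⟩
  obtain ⟨-, Γ₁, A, a, a', B, -, -, h₁, -⟩ := fn_inversion h
  obtain ⟨ha, Γ₂, C, p, p', D, hpf, hsat, h₂, hB⟩ := fn_inversion h₁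
  have hQ := (subClosed_true.funSpec ((p : ℝ) - p')).funSpec 0
  have hΓ₂ : Γ₂.Sat fun y T =>
      (y = 0 → FunSpec 0 (FunSpec ((p : ℝ) - p') fun _ => True) T) ∧ (y = 1 → ListFree T) := by
    intro y S hy
    -- Zero potential of `x` comes from the closure rule, the bound on variable 0 from the enclosing
    -- context.
    refine ⟨?_, fun _ => (hpf y S hy).listFree⟩
    refine hsat (fun y T => y = 0 → FunSpec 0 (FunSpec ((p : ℝ) - p') fun _ => True) T)
      (fun y => hQ.imp _) ?_ y S hy
    have htriv : Γ₁.Sat fun _ _ => True := fun _ _ _ => trivial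
    refine (htriv.insert (R := fun y T => y = 0 → FunSpec 0 (FunSpec ((p : ℝ) - p') fun _ => True) T)
      -- The outer body is itself a function, so `ha` makes the first application cost at least 0.
      (fun _ => ⟨_, _, _, _, rfl, by linarith, hB⟩) fun _ _ h _ h' => absurd h' h).insert
      (fun h => by omega) fun _ _ _ h => h
  have hcase := CostAtLeast.caseList (M := M) (x := 1) (x₁ := 4) (x₂ := 5) (e₀ := .var 3)
    (fun y => (hQ.imp (y = 0)).and (subClosed_listFree.imp (y = 1))) subClosed_true
    (fun _ h => h.2 rfl) (costAtLeast_append_branch M ((p : ℝ) - p'))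
    (fun _ h => by omega) (fun _ h => by omega) fun _ _ h => h.1
  have := (hcase h₂ ((hΓ₂.insert ⟨fun h => by omega, fun h => by omega⟩ fun _ _ _ h => h).insert
    ⟨fun h => by omega, fun h => by omega⟩ fun _ _ _ h => h)).1
  linarith

/-! ### Passing from programs to their subterm `append` -/

theorem Typable.of_letE {M : CostMetric} {x : ℕ} {e₁ e₂ : Expr} (h : Typable M (.letE x e₁ e₂)) :
    Typable M e₁ ∧ Typable M e₂ := by
  obtain ⟨Γ, q, q', A, h⟩ := h
  generalize he : Expr.letE x e₁ e₂ = e at h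
  induction h <;> cases he
  case letE =>
    exact ⟨⟨_, _, _, _, ‹Typing M _ _ e₁ _ _›⟩, ⟨_, _, _, _, ‹Typing M _ _ e₂ _ _›⟩⟩
  all_goals
    rename_i ih
    exact ih rfl

theorem Typable.of_appE {M : CostMetric} {e₁ e₂ : Expr} (h : Typable M (e₁.appE e₂)) :
    Typable M e₁ ∧ Typable M e₂ :=
  ⟨h.of_letE.1, h.of_letE.2.of_letE.1⟩

end AARA

theorem mainTheorem4 (M : AARA.CostMetric) :
    (∀ ℓ₁ ℓ₂ : AARA.Expr, ¬ AARA.Typable M (AARA.mapAppend ℓ₁ ℓ₂)) ∧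
    (∀ e₁ e₂ : AARA.Expr, ¬ AARA.Typable M ((AARA.append.appE e₁).appE e₂)) :=
  ⟨fun _ _ h => AARA.not_typable_append M h.of_appE.1.of_appE.2.of_appE.1,
    fun _ _ h => AARA.not_typable_append M h.of_appE.1.of_appE.1⟩
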